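/- Let $k$ be an algebraically closed field of characteristic $0$. For a connected linear algebraic group $G$ over $k$ with Lie algebra $\mathfrak g$, a Cayley map for $G$ is a birational isomorphism $\lambda\colon G\dashrightarrow\mathfrak g$ (of the underlying varieties) that is equivariant with respect to the action of $G$ on itself by conjugation and the adjoint action of $G$ on $\mathfrak g$, i.e. $\lambda(gXg^{-1})=\operatorname{Ad}_G g\,(\lambda(X))$ for all $g,X\in G$ for which both sides are defined; $G$ is called a Cayley group if it admits a Cayley map. Then $\mathrm{SL}_3$ over $k$ is a Cayley group. -/

import Mathlib

/-!
Classical algebraic geometry inside the affine space `Matrix n n k` of `n × n`-matrices over an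
algebraically closed field `k`: Zariski topology, regular functions, birational isomorphisms,
linear algebraic groups, their Lie algebras, and Cayley maps.
-/

namespace CayleyGroups

variable {n : Type*} {k : Type*} [Field k]

/-- The value at the matrix `A` of a polynomial in the `n × n` matrix entries. -/
noncomputable def evalAt (A : Matrix n n k) (f : MvPolynomial (n × n) k) : k :=
  MvPolynomial.eval (fun ij => A ij.1 ij.2) f

/-- The common zeros in `Matrix n n k` of a set of polynomials in the matrix entries. -/
def zeros (S : Set (MvPolynomial (n × n) k)) : Set (Matrix n n k) :=
  {A | ∀ f ∈ S, evalAt A f = 0}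

/-- The Zariski topology on the affine space `Matrix n n k`: the closed sets are the sets of
common zeros of polynomials. -/
abbrev zariski (n k : Type*) [Field k] : TopologicalSpace (Matrix n n k) :=
  TopologicalSpace.ofClosed {Z | ∃ S : Set (MvPolynomial (n × n) k), Z = zeros S}
    ⟨{1}, by ext A; simp [zeros, evalAt]⟩
    (by
      intro 𝒜 h𝒜
      refine ⟨{f | ∃ Z ∈ 𝒜, ∀ A ∈ Z, evalAt A f = 0}, ?_⟩
      ext A
      constructor
      · rintro hA f ⟨Z, hZ, hf⟩
        exact hf A (hA Z hZ)
      · intro hA Z hZ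
        obtain ⟨S, rfl⟩ := h𝒜 hZ
        exact fun f hf => hA f ⟨zeros S, hZ, fun B hB => hB f hf⟩)
    (by
      rintro _ ⟨S, rfl⟩ _ ⟨S', rfl⟩
      refine ⟨{h | ∃ f ∈ S, ∃ g ∈ S', h = f * g}, ?_⟩
      ext A
      constructor
      · rintro (hA | hA) _ ⟨f, hf, g, hg, rfl⟩
        · have := hA f hf
          simp_all [evalAt]
        · have := hA g hg
          simp_all [evalAt]
      · intro hA
        by_contra hcon
        rw [Set.mem_union, not_or] at hcon
        obtain ⟨h1, h2⟩ := hcon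
        simp only [zeros, Set.mem_ofPred_eq, not_forall] at h1 h2
        obtain ⟨f, hf, hfA⟩ := h1
        obtain ⟨g, hg, hgA⟩ := h2
        have := hA (f * g) ⟨f, hf, g, hg, rfl⟩
        simp_all [evalAt])

/-- `U` is a dense open subset of `X` (in the subspace topology induced on `X` by the Zariski
topology). -/
def IsDenseOpenIn (U X : Set (Matrix n n k)) : Prop :=
  (∃ O : Set (Matrix n n k), @IsOpen _ (zariski n k) O ∧ U = X ∩ O) ∧
    X ⊆ @closure _ (zariski n k) U

/-- The `k`-valued function `φ` is regular on `U`: near every point of `U` it is a quotient of two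
polynomials whose denominator does not vanish. -/
def IsRegularFunOn (φ : Matrix n n k → k) (U : Set (Matrix n n k)) : Prop :=
  ∀ A ∈ U, ∃ p q : MvPolynomial (n × n) k, evalAt A q ≠ 0 ∧
    ∀ B ∈ U, evalAt B q ≠ 0 → φ B = evalAt B p / evalAt B q

/-- A map to the affine space of matrices is regular on `U` if all its entries are. -/
def IsRegularMapOn (φ : Matrix n n k → Matrix n n k) (U : Set (Matrix n n k)) : Prop :=
  ∀ i j, IsRegularFunOn (fun A => φ A i j) U

/-- `e` represents a birational isomorphism from `X` to `Y`: it is an isomorphism (a bijection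
that is regular in both directions) of a dense open subset `e.source` of `X` onto a dense open
subset `e.target` of `Y`. -/
def IsBirationalIso (e : PartialEquiv (Matrix n n k) (Matrix n n k))
    (X Y : Set (Matrix n n k)) : Prop :=
  IsDenseOpenIn e.source X ∧ IsDenseOpenIn e.target Y ∧
    IsRegularMapOn e e.source ∧ IsRegularMapOn e.symm e.target

variable [Fintype n] [DecidableEq n]

/-- The underlying set of a group of invertible matrices, as a subset of the affine space of all
matrices. -/
def groupSet (G : Subgroup (Matrix.GeneralLinearGroup n k)) : Set (Matrix n n k) :=
  {A | ∃ g ∈ G, (g : Matrix n n k) = A}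

/-- `G` is a connected linear algebraic group: a subgroup of `GL n k` which is Zariski closed in
`GL n k` and connected in the Zariski topology. -/
def IsConnectedLinearAlgebraicGroup (G : Subgroup (Matrix.GeneralLinearGroup n k)) : Prop :=
  (∃ Z : Set (Matrix n n k), @IsClosed _ (zariski n k) Z ∧ groupSet G = Z ∩ {A | IsUnit A}) ∧
    @IsConnected _ (zariski n k) (groupSet G)

/-- The Lie algebra of `G ≤ GL n k`, i.e. the tangent space of `G` at the identity, as a subspace
of `Matrix n n k`: those `Y` along which the differential at `1` of every polynomial vanishing on
`G` is zero. -/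
noncomputable def lieAlg (G : Subgroup (Matrix.GeneralLinearGroup n k)) :
    Submodule k (Matrix n n k) where
  carrier := {Y | ∀ f : MvPolynomial (n × n) k, (∀ A ∈ groupSet G, evalAt A f = 0) →
    ∑ i, ∑ j, evalAt 1 (MvPolynomial.pderiv (i, j) f) * Y i j = 0}
  add_mem' := by
    intro Y Z hY hZ f hf
    have h1 := hY f hf
    have h2 := hZ f hf
    simp only [Matrix.add_apply, mul_add, Finset.sum_add_distrib, h1, h2, add_zero]
  zero_mem' := by
    intro f _
    simp
  smul_mem' := by
    intro c Y hY f hf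
    have h1 := hY f hf
    simp only [Matrix.smul_apply, smul_eq_mul, mul_left_comm _ c, ← Finset.mul_sum, h1, mul_zero]

/-- `e` represents a Cayley map for `G`: a birational isomorphism from `G` to its Lie algebra that
is equivariant with respect to the conjugating action of `G` on itself and the adjoint action
`Y ↦ g Y g⁻¹` of `G` on its Lie algebra. -/
def IsCayleyMap (G : Subgroup (Matrix.GeneralLinearGroup n k))
    (e : PartialEquiv (Matrix n n k) (Matrix n n k)) : Prop :=
  IsBirationalIso e (groupSet G) (lieAlg G : Set (Matrix n n k)) ∧
    ∀ g ∈ G, ∀ A ∈ e.source, g.val * A * g⁻¹.val ∈ e.source →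
      e (g.val * A * g⁻¹.val) = g.val * e A * g⁻¹.val

/-- A Cayley group is a connected linear algebraic group that admits a Cayley map. -/
def IsCayleyGroup (G : Subgroup (Matrix.GeneralLinearGroup n k)) : Prop :=
  IsConnectedLinearAlgebraicGroup G ∧
    ∃ e : PartialEquiv (Matrix n n k) (Matrix n n k), IsCayleyMap G e

end CayleyGroups

/-! The substitution `W = (1 - X)⁻¹` lowers the degree of the equation `det X = 1`. Since `X = 1 -
W⁻¹`, it becomes `det W = det (W - 1)`, the cubic terms cancel, and `tr (adj W) - tr W + 1 = 0`
remains. So `SL₃` is equivariantly birational to a quadric in the space of matrices. A scalar matrix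
`c` lies on this quadric when `3c² - 3c + 1 = 0`, which is solvable in `k`, and conjugation fixes
it. In the coordinate `V = W - c` the quadric is `tr (adj V) + (2c - 1) tr V = 0`
(`det_add_smul_sub_one`). As `2c - 1 ≠ 0`, it is smooth at `V = 0`, so a general line through `0`
meets it in exactly one other point. Projection from `0` to the hyperplane `tr = 1`, translated by
`-1/3` to `tr = 0`, is therefore birational and equivariant onto the Lie algebra.

The birational inverse is explicit (`cayleyEquiv`). Density reduces to irreducibility
(`isPreirreducible_of_curves`) and one point of the target, namely `0`. Regularity is bookkeeping in
the algebra `quotientsOn`, where one quotient serves on the whole open set. The Lie algebra is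
identified in `mem_lieAlg_SL`. -/

namespace CayleyGroups

/-! ### Algebras of quotients of functions -/

section RationalFunctions

variable {α k : Type*} [Field k]

/-- The functions that are quotients on `U` of two functions in the algebra `P`. -/
def quotientsOn (P : Subalgebra k (α → k)) (U : Set α) : Subalgebra k (α → k) where
  carrier := {φ | ∃ p ∈ P, ∃ q ∈ P, ∀ a ∈ U, q a ≠ 0 ∧ φ a = p a / q a}
  mul_mem' := by
    rintro φ ψ ⟨p, hp, q, hq, h⟩ ⟨p', hp', q', hq', h'⟩
    refine ⟨p * p', P.mul_mem hp hp', q * q', P.mul_mem hq hq', fun a ha => ?_⟩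
    obtain ⟨h1, h2⟩ := h a ha
    obtain ⟨h1', h2'⟩ := h' a ha
    exact ⟨mul_ne_zero h1 h1', by simp only [Pi.mul_apply, h2, h2', div_mul_div_comm]⟩
  add_mem' := by
    rintro φ ψ ⟨p, hp, q, hq, h⟩ ⟨p', hp', q', hq', h'⟩
    refine ⟨p * q' + q * p', P.add_mem (P.mul_mem hp hq') (P.mul_mem hq hp'), q * q',
      P.mul_mem hq hq', fun a ha => ?_⟩
    obtain ⟨h1, h2⟩ := h a ha
    obtain ⟨h1', h2'⟩ := h' a ha
    exact ⟨mul_ne_zero h1 h1', by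
      simp only [Pi.mul_apply, Pi.add_apply, h2, h2', div_add_div _ _ h1 h1']⟩
  algebraMap_mem' r := ⟨_, P.algebraMap_mem r, 1, P.one_mem, fun a _ => by simp⟩

theorem le_quotientsOn (P : Subalgebra k (α → k)) (U : Set α) : P ≤ quotientsOn P U :=
  fun p hp => ⟨p, hp, 1, P.one_mem, fun a _ => by simp⟩

theorem quotientsOn_anti (P : Subalgebra k (α → k)) {U V : Set α} (h : U ⊆ V) :
    quotientsOn P V ≤ quotientsOn P U :=
  fun _ ⟨p, hp, q, hq, H⟩ => ⟨p, hp, q, hq, fun a ha => H a (h ha)⟩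

theorem inv_mem_quotientsOn {P : Subalgebra k (α → k)} {U : Set α} {φ : α → k}
    (hφ : φ ∈ quotientsOn P U) (h0 : ∀ a ∈ U, φ a ≠ 0) :
    (fun a => (φ a)⁻¹) ∈ quotientsOn P U := by
  obtain ⟨p, hp, q, hq, h⟩ := hφ
  refine ⟨q, hq, p, hp, fun a ha => ?_⟩
  obtain ⟨-, h2⟩ := h a ha
  have := h0 a ha
  rw [h2] at this
  exact ⟨fun h => this (by simp [h]), by simp only [h2, inv_div]⟩

theorem const_mem (S : Subalgebra k (α → k)) (r : k) : (fun _ => r) ∈ S := S.algebraMap_mem r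

variable {n : Type*} [Fintype n] [DecidableEq n]

theorem det_mem (S : Subalgebra k (α → k)) {M : α → Matrix n n k}
    (hM : ∀ i j, (fun a => M a i j) ∈ S) : (fun a => (M a).det) ∈ S := by
  have : (fun a => (M a).det) = (Matrix.of fun i j a => M a i j).det := by
    ext a
    have := (Pi.evalRingHom (fun _ : α => k) a).map_det (Matrix.of fun i j a => M a i j)
    exact this.symm
  rw [this, Matrix.det_apply]
  exact S.sum_mem fun σ _ => S.toSubring.zsmul_mem (S.prod_mem fun i _ => hM _ _) _

theorem adjugate_mem (S : Subalgebra k (α → k)) {M : α → Matrix n n k}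
    (hM : ∀ i j, (fun a => M a i j) ∈ S) (i j : n) : (fun a => (M a).adjugate i j) ∈ S := by
  simp only [Matrix.adjugate_apply]
  refine det_mem S fun i' j' => ?_
  by_cases h : i' = j
  · subst h
    simpa using const_mem S _
  · simpa [Matrix.updateRow_ne h] using hM i' j'

theorem inv_mem {P : Subalgebra k (α → k)} {U : Set α} {M : α → Matrix n n k}
    (hM : ∀ i j, (fun a => M a i j) ∈ quotientsOn P U) (h0 : ∀ a ∈ U, (M a).det ≠ 0) (i j : n) :
    (fun a => (M a)⁻¹ i j) ∈ quotientsOn P U := by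
  simp only [Matrix.inv_def, Matrix.smul_apply, smul_eq_mul, Ring.inverse_eq_inv']
  exact Subalgebra.mul_mem _ (inv_mem_quotientsOn (det_mem _ hM) h0) (adjugate_mem _ hM i j)

omit [Fintype n] [DecidableEq n] in
theorem evalAt_mem (S : Subalgebra k (α → k)) {M : α → Matrix n n k}
    (hM : ∀ i j, (fun a => M a i j) ∈ S) (f : MvPolynomial (n × n) k) :
    (fun a => evalAt (M a) f) ∈ S := by
  induction f using MvPolynomial.induction_on with
  | C r => simpa [evalAt] using const_mem S r
  | add p q hp hq =>
    convert S.add_mem hp hq using 1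
    ext
    simp [evalAt]
  | mul_X p ij hp =>
    convert S.mul_mem hp (hM ij.1 ij.2) using 1
    ext
    simp [evalAt]

end RationalFunctions

/-! ### Zariski topology, irreducibility and tangent vectors -/

section Zariski

variable {n k : Type*} [Field k]

/-- The algebra of polynomial functions on the affine space of matrices. -/
noncomputable def polyFun (n k : Type*) [Field k] : Subalgebra k (Matrix n n k → k) :=
  (AlgHom.mk' (R := k) (A := MvPolynomial (n × n) k) (B := Matrix n n k → k)
    { toFun := fun f A => evalAt A f
      map_one' := by ext; simp [evalAt]
      map_mul' := fun f g => by ext; simp [evalAt]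
      map_zero' := by ext; simp [evalAt]
      map_add' := fun f g => by ext; simp [evalAt] }
    (fun r f => by ext; simp [evalAt])).range

theorem mem_polyFun {φ : Matrix n n k → k} : φ ∈ polyFun n k ↔ ∃ f, ∀ A, evalAt A f = φ A :=
  ⟨fun ⟨f, hf⟩ => ⟨f, fun A => congrFun hf A⟩, fun ⟨f, hf⟩ => ⟨f, funext hf⟩⟩

theorem entry_mem_polyFun (i j : n) : (fun A : Matrix n n k => A i j) ∈ polyFun n k :=
  mem_polyFun.2 ⟨MvPolynomial.X (i, j), fun A => by simp [evalAt]⟩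

theorem isRegularFunOn_of_mem {φ : Matrix n n k → k} {U : Set (Matrix n n k)}
    (h : φ ∈ quotientsOn (polyFun n k) U) : IsRegularFunOn φ U := by
  obtain ⟨p, hp, q, hq, h⟩ := h
  obtain ⟨p, hp⟩ := mem_polyFun.1 hp
  obtain ⟨q, hq⟩ := mem_polyFun.1 hq
  exact fun A hA => ⟨p, q, hq A ▸ (h A hA).1, fun B hB _ => by rw [hp, hq, (h B hB).2]⟩

theorem isClosed_zariski_iff {Z : Set (Matrix n n k)} :
    @IsClosed _ (zariski n k) Z ↔ ∃ S : Set (MvPolynomial (n × n) k), Z = zeros S := by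
  rw [← @isOpen_compl_iff _ _ (zariski n k)]
  change Zᶜᶜ ∈ {Z | ∃ S : Set (MvPolynomial (n × n) k), Z = zeros S} ↔ _
  rw [compl_compl]
  rfl

theorem isOpen_ne_zero {φ : Matrix n n k → k} (hφ : φ ∈ polyFun n k) :
    @IsOpen _ (zariski n k) {A | φ A ≠ 0} := by
  obtain ⟨f, hf⟩ := mem_polyFun.1 hφ
  rw [← @isClosed_compl_iff _ (zariski n k), isClosed_zariski_iff]
  exact ⟨{f}, by ext A; simp [zeros, hf]⟩

theorem isOpen_inter_ne_zero {O : Set (Matrix n n k)} (hO : @IsOpen _ (zariski n k) O)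
    {φ : Matrix n n k → k} (hφ : φ ∈ quotientsOn (polyFun n k) O) :
    @IsOpen _ (zariski n k) (O ∩ {A | φ A ≠ 0}) := by
  obtain ⟨p, hp, q, -, h⟩ := hφ
  -- On `O` the denominator has no zeros, so `φ` vanishes exactly where its numerator does.
  have : O ∩ {A | φ A ≠ 0} = O ∩ {A | p A ≠ 0} := by
    ext A
    refine and_congr_right fun hA => ?_
    obtain ⟨h1, h2⟩ := h A hA
    simp [h2, h1]
  rw [this]
  exact @IsOpen.inter _ (zariski n k) _ _ hO (isOpen_ne_zero hp)

theorem exists_evalAt_ne_zero {O : Set (Matrix n n k)} (hO : @IsOpen _ (zariski n k) O)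
    {A : Matrix n n k} (hA : A ∈ O) :
    ∃ f, evalAt A f ≠ 0 ∧ ∀ B, evalAt B f ≠ 0 → B ∈ O := by
  rw [← @isClosed_compl_iff _ (zariski n k), isClosed_zariski_iff] at hO
  obtain ⟨S, hS⟩ := hO
  have hA' : A ∉ zeros S := hS ▸ fun h => h hA
  simp only [zeros, Set.mem_ofPred_eq, not_forall] at hA'
  obtain ⟨f, hf, hfA⟩ := hA'
  refine ⟨f, hfA, fun B hB => ?_⟩
  by_contra h
  have h' : B ∈ zeros S := hS ▸ h
  exact hB (h' f hf)

/-- The algebra of polynomial functions on the line. -/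
noncomputable def polyFunLine (k : Type*) [Field k] : Subalgebra k (k → k) :=
  (AlgHom.mk' (R := k) (A := Polynomial k) (B := k → k)
    { toFun := fun f s => f.eval s
      map_one' := by ext; simp
      map_mul' := fun f g => by ext; simp
      map_zero' := by ext; simp
      map_add' := fun f g => by ext; simp }
    (fun r f => by ext; simp)).range

theorem mem_polyFunLine {φ : k → k} :
    φ ∈ polyFunLine k ↔ ∃ f : Polynomial k, ∀ s, f.eval s = φ s :=
  ⟨fun ⟨f, hf⟩ => ⟨f, fun A => congrFun hf A⟩, fun ⟨f, hf⟩ => ⟨f, funext hf⟩⟩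

/-- A set is irreducible if any two of its points lie on a rational curve inside it. -/
theorem isPreirreducible_of_curves [Infinite k] {X : Set (Matrix n n k)}
    (h : ∀ A ∈ X, ∀ B ∈ X, ∃ (γ : k → Matrix n n k) (δ : k → k), δ ∈ polyFunLine k ∧
      δ 0 ≠ 0 ∧ δ 1 ≠ 0 ∧ γ 0 = A ∧ γ 1 = B ∧ (∀ s, δ s ≠ 0 → γ s ∈ X) ∧
      ∀ i j, (fun s => γ s i j) ∈ quotientsOn (polyFunLine k) {s | δ s ≠ 0}) :
    @IsPreirreducible _ (zariski n k) X := by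
  intro O₁ O₂ hO₁ hO₂ ⟨A, hAX, hA⟩ ⟨B, hBX, hB⟩
  obtain ⟨f, hfA, hf⟩ := exists_evalAt_ne_zero hO₁ hA
  obtain ⟨g, hgB, hg⟩ := exists_evalAt_ne_zero hO₂ hB
  obtain ⟨γ, δ, hδ, hδ0, hδ1, rfl, rfl, hX, hγ⟩ := h A hAX B hBX
  obtain ⟨p, hp, q, -, hpq⟩ := evalAt_mem _ hγ f
  obtain ⟨p', hp', q', -, hpq'⟩ := evalAt_mem _ hγ g
  beta_reduce at hpq hpq'
  obtain ⟨D, hD⟩ := mem_polyFunLine.1 hδ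
  obtain ⟨P, hP⟩ := mem_polyFunLine.1 hp
  obtain ⟨P', hP'⟩ := mem_polyFunLine.1 hp'
  have hD0 : D ≠ 0 := by
    rintro rfl
    exact hδ0 (by simp [← hD])
  have hP0 : P ≠ 0 := by
    rintro rfl
    exact hfA (by rw [(hpq 0 hδ0).2, ← hP]; simp)
  have hP'0 : P' ≠ 0 := by
    rintro rfl
    exact hgB (by rw [(hpq' 1 hδ1).2, ← hP']; simp)
  -- `P` and `P'` are the numerators of `f` and `g` along the curve. Over an infinite field, a
  -- single parameter avoids the zeros of both and those of `D`; its point lies in both open sets.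
  obtain ⟨s, hs⟩ : ∃ s, (D * P * P').eval s ≠ 0 := by
    by_contra! hcon
    exact mul_ne_zero (mul_ne_zero hD0 hP0) hP'0 (Polynomial.funext fun s => by simp [hcon s])
  simp only [Polynomial.eval_mul, hD, hP, hP', mul_ne_zero_iff] at hs
  obtain ⟨⟨hs1, hs2⟩, hs3⟩ := hs
  refine ⟨γ s, hX s hs1, hf _ ?_, hg _ ?_⟩
  · rw [(hpq s hs1).2]
    exact div_ne_zero hs2 (hpq s hs1).1
  · rw [(hpq' s hs1).2]
    exact div_ne_zero hs3 (hpq' s hs1).1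

theorem isDenseOpenIn_of_isPreirreducible {X O : Set (Matrix n n k)}
    (hX : @IsPreirreducible _ (zariski n k) X) (hO : @IsOpen _ (zariski n k) O)
    (h : (X ∩ O).Nonempty) : IsDenseOpenIn (X ∩ O) X :=
  ⟨⟨O, hO, rfl⟩,
    @subset_closure_inter_of_isPreirreducible_of_isOpen _ (zariski n k) X O hX hO h⟩

/-- The affine line through two matrices. -/
theorem line_mem_polyFunLine (A B : Matrix n n k) (i j : n) :
    (fun s => (A + s • (B - A)) i j) ∈ polyFunLine k :=
  mem_polyFunLine.2 ⟨Polynomial.C (A i j) + Polynomial.X * Polynomial.C (B i j - A i j),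
    fun s => by simp⟩

theorem isPreirreducible_submodule [Infinite k] (L : Submodule k (Matrix n n k)) :
    @IsPreirreducible _ (zariski n k) (L : Set (Matrix n n k)) := by
  refine isPreirreducible_of_curves fun A hA B hB =>
    ⟨fun s => A + s • (B - A), 1, Subalgebra.one_mem _, by simp, by simp, by simp, by simp,
      fun s _ => L.add_mem hA (L.smul_mem s (L.sub_mem hB hA)), fun i j => ?_⟩
  exact le_quotientsOn _ _ (line_mem_polyFunLine A B i j)

/-- The derivative of a polynomial in the matrix entries along the line `1 + s N`. -/
theorem sum_pderiv_eq_derivative [Fintype n] [DecidableEq n] (N : Matrix n n k)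
    (f : MvPolynomial (n × n) k) :
    ∃ F : Polynomial k, (∀ s, F.eval s = evalAt (1 + s • N) f) ∧
      F.derivative.eval 0 = ∑ i, ∑ j, evalAt 1 (MvPolynomial.pderiv (i, j) f) * N i j := by
  induction f using MvPolynomial.induction_on with
  | C r => exact ⟨Polynomial.C r, by simp [evalAt]⟩
  | add p q hp hq =>
    obtain ⟨F, h1, h2⟩ := hp
    obtain ⟨G, h3, h4⟩ := hq
    refine ⟨F + G, fun s => by simp [h1, h3, evalAt], ?_⟩
    simp only [Polynomial.eval_add, h2, h4, ← Finset.sum_add_distrib,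
      ← add_mul, map_add, evalAt]
  | mul_X p ij hp =>
    obtain ⟨F, h1, h2⟩ := hp
    obtain ⟨a, b⟩ := ij
    refine ⟨F * (Polynomial.C ((1 : Matrix n n k) a b) + Polynomial.X * Polynomial.C (N a b)),
      fun s => ?_, ?_⟩
    · simp [h1, evalAt, mul_comm (N a b)]
    have h0 : F.eval 0 = evalAt 1 p := by simp [h1]
    have key : ∀ i j, evalAt 1 (MvPolynomial.pderiv (i, j) (p * MvPolynomial.X (a, b))) * N i j =
        evalAt 1 (MvPolynomial.pderiv (i, j) p) * N i j * (1 : Matrix n n k) a b +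
          evalAt 1 p * (if a = i then if b = j then N i j else 0 else 0) := by
      intro i j
      have hX : evalAt (1 : Matrix n n k) (MvPolynomial.X (a, b)) = (1 : Matrix n n k) a b :=
        MvPolynomial.eval_X _
      have hd : evalAt (1 : Matrix n n k) (MvPolynomial.pderiv (i, j) (MvPolynomial.X (a, b))) =
          if a = i then if b = j then 1 else 0 else 0 := by
        rw [MvPolynomial.pderiv_X]
        by_cases hi : a = i <;> by_cases hj : b = j <;> simp [evalAt, hi, hj]
      have hl : evalAt (1 : Matrix n n k)
          (MvPolynomial.pderiv (i, j) (p * MvPolynomial.X (a, b))) =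
          evalAt 1 p * evalAt 1 (MvPolynomial.pderiv (i, j) (MvPolynomial.X (a, b))) +
            evalAt 1 (MvPolynomial.X (a, b)) * evalAt 1 (MvPolynomial.pderiv (i, j) p) := by
        rw [Derivation.leibniz]
        simp only [evalAt, map_add, smul_eq_mul, map_mul]
      rw [hl, hX, hd]
      split_ifs <;> ring
    simp only [key, Finset.sum_add_distrib, ← Finset.sum_mul, ← Finset.mul_sum, ← h2]
    simp [h0]

/-- A polynomial vanishing on `G` restricts to the zero polynomial on a line contained in `G`,
because `k` is infinite. This gives tangent vectors without knowing generators of the ideal of `G`.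
-/
theorem mem_lieAlg_of_line [Infinite k] [Fintype n] [DecidableEq n]
    {G : Subgroup (Matrix.GeneralLinearGroup n k)} {N : Matrix n n k}
    (h : ∀ s : k, 1 + s • N ∈ groupSet G) : N ∈ lieAlg G := by
  intro f hf
  obtain ⟨F, h1, h2⟩ := sum_pderiv_eq_derivative N f
  have : F = 0 := Polynomial.funext fun s => by simp [h1, hf _ (h s)]
  rw [← h2, this]
  simp

end Zariski

/-! ### The group `SL₃` and its Lie algebra -/

section SpecialLinear

variable {k : Type*} [Field k]

/-- The special linear group as a subgroup of the general linear group. -/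
abbrev SL₃ (k : Type*) [Field k] : Subgroup (Matrix.GeneralLinearGroup (Fin 3) k) :=
  (Matrix.SpecialLinearGroup.toGL :
    Matrix.SpecialLinearGroup (Fin 3) k →* Matrix.GeneralLinearGroup (Fin 3) k).range

theorem mem_groupSet_SL {A : Matrix (Fin 3) (Fin 3) k} : A ∈ groupSet (SL₃ k) ↔ A.det = 1 := by
  constructor
  · rintro ⟨_, ⟨g, rfl⟩, rfl⟩
    exact g.2
  · exact fun h => ⟨_, ⟨⟨A, h⟩, rfl⟩, rfl⟩

theorem det_mem_polyFun : (fun A : Matrix (Fin 3) (Fin 3) k => A.det) ∈ polyFun (Fin 3) k :=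
  det_mem _ entry_mem_polyFun

theorem isPreirreducible_SL [Infinite k] :
    @IsPreirreducible _ (zariski (Fin 3) k) (groupSet (SL₃ k)) := by
  refine isPreirreducible_of_curves fun A hA B hB => ?_
  rw [mem_groupSet_SL] at hA hB
  -- The line from `A` to `B` leaves `SL₃`; dividing its first column by the determinant brings it
  -- back and keeps both endpoints.
  refine ⟨fun s => (A + s • (B - A)) * Matrix.diagonal ![(A + s • (B - A)).det⁻¹, 1, 1],
    fun s => (A + s • (B - A)).det, det_mem _ (line_mem_polyFunLine A B), by simp [hA],
    by simp [hB], ?_, ?_, fun s hs => ?_, fun i j => ?_⟩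
  · ext i j
    fin_cases j <;> simp [hA]
  · ext i j
    fin_cases j <;> simp [hB]
  · rw [mem_groupSet_SL, Matrix.det_mul, Matrix.det_diagonal, Fin.prod_univ_three]
    simpa using mul_inv_cancel₀ hs
  · simp only [Matrix.mul_diagonal]
    have hl := line_mem_polyFunLine A B
    refine Subalgebra.mul_mem _ (le_quotientsOn _ _ (hl i j)) ?_
    fin_cases j
    · exact inv_mem_quotientsOn (le_quotientsOn _ _ (det_mem _ hl)) fun s hs => hs
    · exact const_mem _ 1
    · exact const_mem _ 1

theorem isConnectedLinearAlgebraicGroup_SL [Infinite k] :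
    IsConnectedLinearAlgebraicGroup (SL₃ k) := by
  refine ⟨⟨groupSet (SL₃ k), ?_, ?_⟩, ⟨1, mem_groupSet_SL.2 (by simp)⟩,
    @IsPreirreducible.isPreconnected _ (zariski (Fin 3) k) _ isPreirreducible_SL⟩
  · obtain ⟨f, hf⟩ := mem_polyFun.1 (det_mem_polyFun (k := k))
    rw [isClosed_zariski_iff]
    refine ⟨{f - 1}, ?_⟩
    ext A
    have : evalAt A (f - 1) = A.det - 1 := by rw [← hf]; simp [evalAt]
    simp [mem_groupSet_SL, zeros, this, sub_eq_zero]
  · refine (Set.inter_eq_left.2 fun A hA => ?_).symm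
    rw [mem_groupSet_SL] at hA
    simp [Matrix.isUnit_iff_isUnit_det, hA]

theorem mem_lieAlg_SL [Infinite k] {Y : Matrix (Fin 3) (Fin 3) k} :
    Y ∈ lieAlg (SL₃ k) ↔ Y.trace = 0 := by
  constructor
  · intro hY
    obtain ⟨f, hf⟩ := mem_polyFun.1 (det_mem_polyFun (k := k))
    have h := hY (f - 1) fun A hA => by
      rw [mem_groupSet_SL] at hA
      rw [← sub_eq_zero, ← hf] at hA
      simpa [evalAt] using hA
    obtain ⟨F, h1, h2⟩ := sum_pderiv_eq_derivative Y (f - 1)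
    -- The derivative of `det (1 + s Y)` at `s = 0` is `tr Y`.
    have hF : F = (1 + (Polynomial.X : Polynomial k) • Y.map Polynomial.C).det - 1 := by
      refine Polynomial.funext fun s => ?_
      rw [h1]
      have : evalAt (1 + s • Y) (f - 1) = (1 + s • Y).det - 1 := by rw [← hf]; simp [evalAt]
      rw [this]
      simp [Matrix.det_fin_three, mul_comm s]
    rw [← h2, hF] at h
    simpa [Matrix.derivative_det_one_add_X_smul] using h
  · intro hY
    -- The traceless matrices are spanned by square-zero ones, and these are directions of lines in
    -- `SL₃`. For the diagonal part, `e7` and `e8` replace `diag(1, -1, 0)` and `diag(0, 1, -1)`;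
    -- the other coefficients below compensate for their off-diagonal entries.
    have hline : ∀ N : Matrix (Fin 3) (Fin 3) k, (∀ s : k, (1 + s • N).det = 1) →
        N ∈ lieAlg (SL₃ k) := fun N hN => mem_lieAlg_of_line fun s => mem_groupSet_SL.2 (hN s)
    have e1 := hline !![0, 1, 0; 0, 0, 0; 0, 0, 0] fun s => by simp [Matrix.det_fin_three]
    have e2 := hline !![0, 0, 1; 0, 0, 0; 0, 0, 0] fun s => by simp [Matrix.det_fin_three]
    have e3 := hline !![0, 0, 0; 0, 0, 1; 0, 0, 0] fun s => by simp [Matrix.det_fin_three]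
    have e4 := hline !![0, 0, 0; 1, 0, 0; 0, 0, 0] fun s => by simp [Matrix.det_fin_three]
    have e5 := hline !![0, 0, 0; 0, 0, 0; 1, 0, 0] fun s => by simp [Matrix.det_fin_three]
    have e6 := hline !![0, 0, 0; 0, 0, 0; 0, 1, 0] fun s => by simp [Matrix.det_fin_three]
    have e7 := hline !![1, -1, 0; 1, -1, 0; 0, 0, 0] fun s => by
      simp [Matrix.det_fin_three]; ring
    have e8 := hline !![0, 0, 0; 0, 1, -1; 0, 1, -1] fun s => by
      simp [Matrix.det_fin_three]; ring
    set L := lieAlg (SL₃ k)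
    rw [Matrix.trace_fin_three] at hY
    have hY' : Y 2 2 = -Y 0 0 - Y 1 1 := by linear_combination hY
    have : Y = (Y 0 1 + Y 0 0) • !![0, 1, 0; 0, 0, 0; 0, 0, 0] +
        Y 0 2 • !![0, 0, 1; 0, 0, 0; 0, 0, 0] +
        (Y 1 2 + (Y 0 0 + Y 1 1)) • !![0, 0, 0; 0, 0, 1; 0, 0, 0] +
        (Y 1 0 - Y 0 0) • !![0, 0, 0; 1, 0, 0; 0, 0, 0] +
        Y 2 0 • !![0, 0, 0; 0, 0, 0; 1, 0, 0] +
        (Y 2 1 - (Y 0 0 + Y 1 1)) • !![0, 0, 0; 0, 0, 0; 0, 1, 0] +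
        Y 0 0 • !![1, -1, 0; 1, -1, 0; 0, 0, 0] +
        (Y 0 0 + Y 1 1) • !![0, 0, 0; 0, 1, -1; 0, 1, -1] := by
      ext i j
      fin_cases i <;> fin_cases j <;> simp [hY'] <;> ring
    rw [this]
    exact L.add_mem (L.add_mem (L.add_mem (L.add_mem (L.add_mem (L.add_mem (L.add_mem
      (L.smul_mem _ e1) (L.smul_mem _ e2)) (L.smul_mem _ e3)) (L.smul_mem _ e4))
      (L.smul_mem _ e5)) (L.smul_mem _ e6)) (L.smul_mem _ e7)) (L.smul_mem _ e8)

end SpecialLinear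

/-! ### The quadric, its projection and the Cayley map -/

section CayleyMap

variable {k : Type*} [Field k]

/-- The matrix `(1 - X)⁻¹ - c`. -/
noncomputable def shiftedResolvent (c : k) (X : Matrix (Fin 3) (Fin 3) k) : Matrix (Fin 3) (Fin 3) k := (1 - X)⁻¹ - c • 1

/-- The inverse of `shiftedResolvent`. -/
noncomputable def unresolve (c : k) (V : Matrix (Fin 3) (Fin 3) k) : Matrix (Fin 3) (Fin 3) k := 1 - (V + c • 1)⁻¹

/-- The central projection of matrices to the hyperplane of matrices of trace `1`, translated
to the hyperplane of matrices of trace `0`. -/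
noncomputable def projectTrace (V : Matrix (Fin 3) (Fin 3) k) : Matrix (Fin 3) (Fin 3) k := V.trace⁻¹ • V - (3 : k)⁻¹ • 1

/-- The point of the quadric `tr (adj V) + d tr V = 0` on the line through `0` and `Y + 1/3`. -/
noncomputable def liftQuadric (d : k) (Y : Matrix (Fin 3) (Fin 3) k) : Matrix (Fin 3) (Fin 3) k :=
  (-d * (Y + (3 : k)⁻¹ • 1).adjugate.trace⁻¹) • (Y + (3 : k)⁻¹ • 1)

theorem adjugate_trace_smul (t : k) (V : Matrix (Fin 3) (Fin 3) k) :
    (t • V).adjugate.trace = t ^ 2 * V.adjugate.trace := by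
  simp [Matrix.adjugate_smul]

theorem projectTrace_add (V : Matrix (Fin 3) (Fin 3) k) : projectTrace V + (3 : k)⁻¹ • 1 = V.trace⁻¹ • V := by
  simp [projectTrace]

theorem trace_projectTrace [CharZero k] {V : Matrix (Fin 3) (Fin 3) k} (h : V.trace ≠ 0) :
    (projectTrace V).trace = 0 := by
  simp [projectTrace, h]

theorem liftQuadric_projectTrace {d : k} (hd : d ≠ 0) {V : Matrix (Fin 3) (Fin 3) k} (h : V.trace ≠ 0)
    (hV : V.adjugate.trace + d * V.trace = 0) : liftQuadric d (projectTrace V) = V := by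
  rw [liftQuadric, projectTrace_add, adjugate_trace_smul, smul_smul, eq_neg_of_add_eq_zero_left hV]
  convert one_smul k V using 2
  field_simp

theorem trace_liftQuadric [CharZero k] (d : k) {Y : Matrix (Fin 3) (Fin 3) k} (hY : Y.trace = 0) :
    (liftQuadric d Y).trace = -d * (Y + (3 : k)⁻¹ • 1).adjugate.trace⁻¹ := by
  simp [liftQuadric, hY]

theorem projectTrace_liftQuadric [CharZero k] {d : k} (hd : d ≠ 0)
    {Y : Matrix (Fin 3) (Fin 3) k} (hY : Y.trace = 0)
    (h : (Y + (3 : k)⁻¹ • 1).adjugate.trace ≠ 0) : projectTrace (liftQuadric d Y) = Y := by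
  rw [projectTrace, trace_liftQuadric d hY, liftQuadric, smul_smul, inv_mul_cancel₀, one_smul,
    add_sub_cancel_right]
  exact mul_ne_zero (neg_ne_zero.2 hd) (inv_ne_zero h)

/-- For `U = Y + 1/3` of trace `1`, the scalar `t = -d / tr (adj U)` is the nonzero root of `t² tr
(adj U) + d t = 0`. If `tr (adj U) = 0`, the convention `0⁻¹ = 0` gives `t = 0`, which is still on
the quadric. -/
theorem liftQuadric_mem_quadric [CharZero k] (d : k)
    {Y : Matrix (Fin 3) (Fin 3) k} (hY : Y.trace = 0) :
    (liftQuadric d Y).adjugate.trace + d * (liftQuadric d Y).trace = 0 := by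
  rw [trace_liftQuadric d hY, liftQuadric, adjugate_trace_smul]
  field_simp
  ring

/-- The cubic terms cancel, and the constant term is `3c² - 3c + 1`: the hypothesis says that the
quadric passes through `V = 0`. -/
theorem det_add_smul_sub_one {c : k} (hc : 3 * c ^ 2 - 3 * c + 1 = 0)
    (V : Matrix (Fin 3) (Fin 3) k) :
    (V + c • 1).det - (V + c • 1 - 1).det = V.adjugate.trace + (2 * c - 1) * V.trace := by
  simp [Matrix.det_fin_three, Matrix.adjugate_fin_three, Matrix.trace_fin_three]
  linear_combination hc

theorem unresolve_shiftedResolvent (c : k) {X : Matrix (Fin 3) (Fin 3) k} (h : (1 - X).det ≠ 0) :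
    unresolve c (shiftedResolvent c X) = X := by
  rw [unresolve, shiftedResolvent, sub_add_cancel, Matrix.nonsing_inv_nonsing_inv _ h.isUnit,
    sub_sub_cancel]

theorem shiftedResolvent_unresolve {c : k} {V : Matrix (Fin 3) (Fin 3) k} (h : (V + c • 1).det ≠ 0) :
    shiftedResolvent c (unresolve c V) = V := by
  rw [unresolve, shiftedResolvent, sub_sub_cancel, Matrix.nonsing_inv_nonsing_inv _ h.isUnit,
    add_sub_cancel_right]

theorem det_unresolve (c : k) {V : Matrix (Fin 3) (Fin 3) k} (h : (V + c • 1).det ≠ 0) :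
    (unresolve c V).det = (V + c • 1 - 1).det / (V + c • 1).det := by
  rw [eq_div_iff h, unresolve, ← Matrix.det_mul, sub_mul, one_mul,
    Matrix.nonsing_inv_mul _ h.isUnit]

theorem det_unresolve_eq_one_iff {c : k} (hc : 3 * c ^ 2 - 3 * c + 1 = 0) {V : Matrix (Fin 3) (Fin 3) k}
    (h : (V + c • 1).det ≠ 0) :
    (unresolve c V).det = 1 ↔ V.adjugate.trace + (2 * c - 1) * V.trace = 0 := by
  rw [det_unresolve c h, div_eq_one_iff_eq h, ← det_add_smul_sub_one hc, sub_eq_zero, eq_comm]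

theorem det_one_sub_unresolve {c : k} {V : Matrix (Fin 3) (Fin 3) k} (h : (V + c • 1).det ≠ 0) :
    (1 - unresolve c V).det ≠ 0 := by
  rw [unresolve, sub_sub_cancel, Matrix.det_nonsing_inv, Ring.inverse_eq_inv']
  exact inv_ne_zero h

theorem det_shiftedResolvent_add {c : k} {X : Matrix (Fin 3) (Fin 3) k} (h : (1 - X).det ≠ 0) :
    (shiftedResolvent c X + c • 1).det ≠ 0 := by
  rw [shiftedResolvent, sub_add_cancel, Matrix.det_nonsing_inv, Ring.inverse_eq_inv']
  exact inv_ne_zero h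

/-- The open set of matrices at which the Cayley map is defined. -/
def cayleySource (c : k) : Set (Matrix (Fin 3) (Fin 3) k) :=
  {X | (1 - X).det ≠ 0} ∩ {X | (shiftedResolvent c X).trace ≠ 0}

/-- The open set of matrices at which the inverse of the Cayley map is defined. -/
def cayleyTarget (c : k) : Set (Matrix (Fin 3) (Fin 3) k) :=
  {Y | (Y + (3 : k)⁻¹ • 1).adjugate.trace ≠ 0} ∩
    {Y | (liftQuadric (2 * c - 1) Y + c • 1).det ≠ 0}

/-- The Cayley map of `SL₃`: the map `X ↦ (1 - X)⁻¹` takes `SL₃` to a quadric, which is then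
projected from its scalar matrix `c`. -/
noncomputable def cayleyEquiv [CharZero k] {c : k} (hc : 3 * c ^ 2 - 3 * c + 1 = 0)
    (hd : 2 * c - 1 ≠ 0) : PartialEquiv (Matrix (Fin 3) (Fin 3) k) (Matrix (Fin 3) (Fin 3) k) where
  toFun X := projectTrace (shiftedResolvent c X)
  invFun Y := unresolve c (liftQuadric (2 * c - 1) Y)
  source := {X | X.det = 1} ∩ cayleySource c
  target := {Y | Y.trace = 0} ∩ cayleyTarget c
  map_source' := by
    rintro X ⟨hX, h1, h2⟩
    have h3 := det_shiftedResolvent_add (c := c) h1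
    have hq := (det_unresolve_eq_one_iff hc h3).1 (by rwa [unresolve_shiftedResolvent c h1])
    refine ⟨trace_projectTrace h2, ?_, ?_⟩
    · simp only [Set.mem_ofPred_eq] at h2 ⊢
      -- On the quadric, `tr (adj (V / tr V)) = -(2c - 1) / tr V`, which is nonzero.
      rw [projectTrace_add, adjugate_trace_smul, eq_neg_of_add_eq_zero_left hq]
      simp [hd, h2]
    · simpa only [Set.mem_ofPred_eq, liftQuadric_projectTrace hd h2 hq] using h3
  map_target' := by
    rintro Y ⟨hY, h1, h2⟩
    refine ⟨(det_unresolve_eq_one_iff hc h2).2 (liftQuadric_mem_quadric _ hY),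
      det_one_sub_unresolve h2, ?_⟩
    simp only [Set.mem_ofPred_eq, shiftedResolvent_unresolve h2, trace_liftQuadric _ hY]
    exact mul_ne_zero (neg_ne_zero.2 hd) (inv_ne_zero h1)
  left_inv' := by
    rintro X ⟨hX, h1, h2⟩
    have h3 := det_shiftedResolvent_add (c := c) h1
    have hq := (det_unresolve_eq_one_iff hc h3).1 (by rwa [unresolve_shiftedResolvent c h1])
    rw [liftQuadric_projectTrace hd h2 hq, unresolve_shiftedResolvent c h1]
  right_inv' := by
    rintro Y ⟨hY, h1, h2⟩
    rw [shiftedResolvent_unresolve h2, projectTrace_liftQuadric hd hY h1]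

/-! ### Regularity, open domains and equivariance -/

section Regularity

variable {α : Type*} (S : Subalgebra k (α → k)) {M N : α → Matrix (Fin 3) (Fin 3) k}

theorem matrix_add_mem (hM : ∀ i j, (fun a => M a i j) ∈ S) (hN : ∀ i j, (fun a => N a i j) ∈ S)
    (i j : Fin 3) : (fun a => (M a + N a) i j) ∈ S := S.add_mem (hM i j) (hN i j)

theorem matrix_sub_mem (hM : ∀ i j, (fun a => M a i j) ∈ S) (hN : ∀ i j, (fun a => N a i j) ∈ S)
    (i j : Fin 3) : (fun a => (M a - N a) i j) ∈ S := S.sub_mem (hM i j) (hN i j)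

theorem matrix_smul_mem {t : α → k} (ht : t ∈ S) (hM : ∀ i j, (fun a => M a i j) ∈ S)
    (i j : Fin 3) : (fun a => (t a • M a) i j) ∈ S := S.mul_mem ht (hM i j)

theorem trace_mem (hM : ∀ i j, (fun a => M a i j) ∈ S) : (fun a => (M a).trace) ∈ S := by
  simp only [Matrix.trace_fin_three]
  exact S.add_mem (S.add_mem (hM 0 0) (hM 1 1)) (hM 2 2)

theorem matrix_const_mem (A : Matrix (Fin 3) (Fin 3) k) (i j : Fin 3) : (fun _ : α => A i j) ∈ S := const_mem S _

end Regularity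

theorem one_sub_mem (i j : Fin 3) : (fun X : Matrix (Fin 3) (Fin 3) k => (1 - X) i j) ∈ polyFun (Fin 3) k :=
  matrix_sub_mem _ (matrix_const_mem _ 1) entry_mem_polyFun i j

theorem add_third_mem (i j : Fin 3) :
    (fun Y : Matrix (Fin 3) (Fin 3) k => (Y + (3 : k)⁻¹ • 1) i j) ∈ polyFun (Fin 3) k :=
  matrix_add_mem _ entry_mem_polyFun (matrix_const_mem _ _) i j

theorem shiftedResolvent_mem (c : k) (i j : Fin 3) : (fun X => shiftedResolvent c X i j) ∈
    quotientsOn (polyFun (Fin 3) k) {X | (1 - X).det ≠ 0} :=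
  matrix_sub_mem _ (inv_mem (fun i j => le_quotientsOn _ _ (one_sub_mem i j)) fun _ h => h)
    (matrix_const_mem _ _) i j

theorem liftQuadric_mem (d : k) (i j : Fin 3) : (fun Y => liftQuadric d Y i j) ∈
    quotientsOn (polyFun (Fin 3) k) {Y | (Y + (3 : k)⁻¹ • 1).adjugate.trace ≠ 0} :=
  matrix_smul_mem _ (Subalgebra.mul_mem _ (const_mem _ _) (inv_mem_quotientsOn
    (le_quotientsOn _ _ (trace_mem _ (adjugate_mem _ add_third_mem))) fun _ h => h))
    (fun i j => le_quotientsOn _ _ (add_third_mem i j)) i j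

theorem isOpen_cayleySource (c : k) : @IsOpen _ (zariski (Fin 3) k) (cayleySource c) :=
  isOpen_inter_ne_zero (isOpen_ne_zero (det_mem _ one_sub_mem))
    (trace_mem _ (shiftedResolvent_mem c))

theorem isOpen_cayleyTarget (c : k) : @IsOpen _ (zariski (Fin 3) k) (cayleyTarget c) :=
  isOpen_inter_ne_zero (isOpen_ne_zero (trace_mem _ (adjugate_mem _ add_third_mem)))
    (det_mem _ (matrix_add_mem _ (liftQuadric_mem _) (matrix_const_mem _ _)))

theorem isRegularMapOn_cayley (c : k) :
    IsRegularMapOn (fun X => projectTrace (shiftedResolvent c X)) (cayleySource c) := by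
  refine fun i j => isRegularFunOn_of_mem ?_
  have h := fun i j => quotientsOn_anti _ (U := cayleySource c) Set.inter_subset_left
    (shiftedResolvent_mem c i j)
  exact matrix_sub_mem _ (matrix_smul_mem _ (inv_mem_quotientsOn (trace_mem _ h)
    fun _ h => h.2) h) (matrix_const_mem _ _) i j

theorem isRegularMapOn_cayley_symm (c : k) :
    IsRegularMapOn (fun Y => unresolve c (liftQuadric (2 * c - 1) Y)) (cayleyTarget c) := by
  refine fun i j => isRegularFunOn_of_mem ?_
  have h := fun i j => quotientsOn_anti _ (U := cayleyTarget c) Set.inter_subset_left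
    (liftQuadric_mem (2 * c - 1) i j)
  exact matrix_sub_mem _ (matrix_const_mem _ 1) (inv_mem (matrix_add_mem _ h
    (matrix_const_mem _ _)) fun _ h => h.2) i j

theorem IsRegularMapOn.mono {n : Type*} {φ : Matrix n n k → Matrix n n k}
    {U V : Set (Matrix n n k)} (h : IsRegularMapOn φ V) (hUV : U ⊆ V) : IsRegularMapOn φ U :=
  fun i j A hA => by
    obtain ⟨p, q, h1, h2⟩ := h i j A (hUV hA)
    exact ⟨p, q, h1, fun B hB => h2 B (hUV hB)⟩

theorem zero_mem_cayleyTarget [CharZero k] {c : k} (hc : 3 * c ^ 2 - 3 * c + 1 = 0) :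
    (0 : Matrix (Fin 3) (Fin 3) k) ∈ cayleyTarget c := by
  have h1 : c ≠ 1 := by
    rintro rfl
    norm_num at hc
  have h3 : ((0 : Matrix (Fin 3) (Fin 3) k) + (3 : k)⁻¹ • 1).adjugate.trace = 3⁻¹ := by
    rw [zero_add, adjugate_trace_smul]
    simp
    norm_num
  refine ⟨by simp only [Set.mem_ofPred_eq, h3]; simp, ?_⟩
  -- The line of scalar matrices meets the quadric at the two roots `c` and `1 - c` of `3x² - 3x +
  -- 1`, so `0` lifts to `W = 1 - c`.
  have : liftQuadric (2 * c - 1) (0 : Matrix (Fin 3) (Fin 3) k) + c • 1 = (1 - c) • (1 : Matrix (Fin 3) (Fin 3) k) := by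
    rw [liftQuadric, h3, zero_add, smul_smul, ← add_smul]
    congr 1
    field_simp
    ring
  simp only [Set.mem_ofPred_eq, this, Matrix.det_smul]
  simpa [sub_eq_zero] using h1.symm

theorem shiftedResolvent_conj (c : k) (g : Matrix.GeneralLinearGroup (Fin 3) k) (X : Matrix (Fin 3) (Fin 3) k) :
    shiftedResolvent c (g.val * X * g⁻¹.val) = g.val * shiftedResolvent c X * g⁻¹.val := by
  have h1 : (1 : Matrix (Fin 3) (Fin 3) k) - g.val * X * g⁻¹.val = g.val * (1 - X) * g⁻¹.val := by
    simp [mul_sub, sub_mul]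
  have h2 : (g⁻¹.val)⁻¹ = g.val := by
    rw [← Matrix.coe_units_inv, inv_inv]
  rw [shiftedResolvent, shiftedResolvent, h1, Matrix.mul_inv_rev, Matrix.mul_inv_rev, h2,
    ← Matrix.coe_units_inv, mul_sub, sub_mul, mul_assoc]
  simp

theorem projectTrace_conj (g : Matrix.GeneralLinearGroup (Fin 3) k) (V : Matrix (Fin 3) (Fin 3) k) :
    projectTrace (g.val * V * g⁻¹.val) = g.val * projectTrace V * g⁻¹.val := by
  have h : (g.val * V * g⁻¹.val).trace = V.trace := by
    rw [Matrix.trace_mul_comm, ← mul_assoc, Units.inv_mul, one_mul]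
  rw [projectTrace, h, projectTrace, mul_sub, sub_mul]
  simp

end CayleyMap

end CayleyGroups

/-! ### Assembly of the Cayley map -/

open CayleyGroups in
theorem proposition9p1 {k : Type*} [Field k] [IsAlgClosed k] [CharZero k] :
    CayleyGroups.IsCayleyGroup
      (Matrix.SpecialLinearGroup.toGL :
        Matrix.SpecialLinearGroup (Fin 3) k →* Matrix.GeneralLinearGroup (Fin 3) k).range := by
  have : Infinite k := IsAlgClosed.instInfinite
  -- With `d = 2c - 1`, the equation `3c² - 3c + 1 = 0` is `d² = -1/3`, which also makes `d`
  -- nonzero.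
  obtain ⟨d, hd⟩ := IsAlgClosed.exists_pow_nat_eq (-3⁻¹ : k) two_pos
  obtain ⟨c, rfl⟩ : ∃ c, d = 2 * c - 1 := ⟨(d + 1) / 2, by ring⟩
  have hc : 3 * c ^ 2 - 3 * c + 1 = 0 := by
    linear_combination (3 / 4 : k) * hd
  have hd0 : 2 * c - 1 ≠ 0 := by
    intro h
    rw [h] at hd
    norm_num at hd
  have hG : groupSet (Matrix.SpecialLinearGroup.toGL :
      Matrix.SpecialLinearGroup (Fin 3) k →* Matrix.GeneralLinearGroup (Fin 3) k).range =
        {X | X.det = 1} := Set.ext fun _ => mem_groupSet_SL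
  have hL : (lieAlg (Matrix.SpecialLinearGroup.toGL :
      Matrix.SpecialLinearGroup (Fin 3) k →* Matrix.GeneralLinearGroup (Fin 3) k).range :
        Set (Matrix (Fin 3) (Fin 3) k)) = {Y | Y.trace = 0} := Set.ext fun _ => mem_lieAlg_SL
  have h0 : (0 : Matrix (Fin 3) (Fin 3) k) ∈ (cayleyEquiv hc hd0).target :=
    ⟨Matrix.trace_zero _ _, zero_mem_cayleyTarget hc⟩
  refine ⟨isConnectedLinearAlgebraicGroup_SL, cayleyEquiv hc hd0, ⟨?_, ?_, ?_, ?_⟩, ?_⟩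
  · rw [hG]
    exact isDenseOpenIn_of_isPreirreducible (hG ▸ isPreirreducible_SL) (isOpen_cayleySource c)
      -- The image of `0` under the inverse map shows that the source is nonempty.
      ⟨_, (cayleyEquiv hc hd0).map_target h0⟩
  · rw [hL]
    exact isDenseOpenIn_of_isPreirreducible (hL ▸ isPreirreducible_submodule _)
      (isOpen_cayleyTarget c) ⟨_, h0⟩
  · exact (isRegularMapOn_cayley c).mono Set.inter_subset_right
  · exact (isRegularMapOn_cayley_symm c).mono Set.inter_subset_right
  · intro g _ A _ _
    change projectTrace (shiftedResolvent c _) = _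
    rw [shiftedResolvent_conj, projectTrace_conj]
    rfl
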